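/- Let $\ell\ge 2$, let $n_0=c,\,n_1,\dots,n_{\ell-1},\,n_\ell=d$ be layer widths, let $X\in\mathbb{R}^{d\times m}$ be such that $XX^\top$ is positive definite (so $d\le m$), let $Y\in\mathbb{R}^{c\times m}$, and for weights $W=(W_1,\dots,W_\ell)$, $W_i\in\mathbb{R}^{n_{i-1}\times n_i}$, put $$f(W)=\|Y-W_1\,\phi(W_2W_3\cdots W_\ell X)\|_{\rm F}^2,$$ where $\phi(x)=\max\{bx,x\}$, $0<b\le 1$, is the leaky ReLU, applied entrywise. Let $h>0$. Let $W$ be any point (for example, an iterate of gradient descent) such that - $\lambda_{\min}(W_1^\top W_1)\ge h$; - all the layers are weakly balanced: $\|W_1\|_{\rm F}=\dots=\|W_\ell\|_{\rm F}$; - the layers $W_2,\dots,W_\ell$ are strongly balanced: $W_i^\top W_i=W_{i+1}W_{i+1}^\top$ for $2\le i\le \ell-1$. If all entries of the pre-activation $W_2W_3\cdots W_\ell X$ are non-zero, then $f$ is twice differentiable at $W$. Moreover, whenever $f$ is twice differentiable at $W$ (i.e. differentiable in a neighbourhood of $W$ with gradient differentiable at $W$), with $f^*=\inf f$ it holds that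 $$\|\nabla^2 f(W)\|_2\le H_0+H_1 f(W)=(H_0+H_1f^*)+H_1\,(f(W)-f^*),$$ where $\|\cdot\|_2$ is the spectral norm (of the Hessian with respect to all entries of $W_1,\dots,W_\ell$), and $$H_0=\ell^2\left(\frac{16d^{\ell-2}\|Y\|_{\rm F}^2}{hb^2\lambda_{\min}(XX^\top)}\|X\|_2^2+2\left(\frac{4d^{\ell-2}\|Y\|_{\rm F}^2}{hb^2\lambda_{\min}(XX^\top)}\right)^{\frac{\ell-2}{2\ell-2}}\|X\|_2+2\left(\frac{4d^{\ell-2}}{hb^2\lambda_{\min}(XX^\top)}\right)^{\frac{\ell-2}{2\ell-2}}\|X\|_2\right),$$ $$H_1=\ell^2\left(\frac{16d^{\ell-2}}{hb^2\lambda_{\min}(XX^\top)}\|X\|_2^2+2\left(\frac{4d^{\ell-2}\|Y\|_{\rm F}^2}{hb^2\lambda_{\min}(XX^\top)}\right)^{\frac{\ell-2}{2\ell-2}}\|X\|_2+2\left(\frac{4d^{\ell-2}}{hb^2\lambda_{\min}(XX^\top)}\right)^{\frac{\ell-2}{2\ell-2}}\|X\|_2\right)$$ (with $0^0=1$ when $\ell=2$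 and $Y=0$). -/

import Mathlib

open scoped Matrix Topology

noncomputable section

namespace DeepNet

/-- Frobenius norm of a real matrix (Mathlib's Frobenius norm). -/
def frobNorm {p q : ℕ} (A : Matrix (Fin p) (Fin q) ℝ) : ℝ :=
  letI := Matrix.frobeniusNormedAddCommGroup (m := Fin p) (n := Fin q) (α := ℝ)
  ‖A‖

/-- Spectral norm of a real matrix: the operator norm of `A` between Euclidean spaces
(Mathlib's `L2` operator norm). -/
def specNorm {p q : ℕ} (A : Matrix (Fin p) (Fin q) ℝ) : ℝ :=
  letI := Matrix.instL2OpNormedAddCommGroup (m := Fin p) (n := Fin q) (𝕜 := ℝ)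
  ‖A‖

/-- Smallest eigenvalue of a real symmetric matrix. -/
def lambdaMin {p : ℕ} (A : Matrix (Fin p) (Fin p) ℝ) : ℝ :=
  sInf (spectrum ℝ A)

/-- Leaky ReLU with slopes `1` and `b`. -/
def leakyReLU (b x : ℝ) : ℝ := max (b * x) x

/-- The weights of a network with `ℓ` layers and widths `n 0, …, n ℓ`: the vector of all the
entries of the layers, with its Euclidean norm. The values of `n` beyond `ℓ` are not used. -/
abbrev Params (ℓ : ℕ) (n : ℕ → ℕ) : Type :=
  EuclideanSpace ℝ (Σ i : Fin ℓ, Fin (n i) × Fin (n (i + 1)))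

/-- The layers are stored with indices `0, …, ℓ - 1`: `layer W i` is the matrix usually
written `W_{i+1}`, of size `n i × n (i+1)`. -/
def layer {ℓ : ℕ} {n : ℕ → ℕ} (W : Params ℓ n) (i : ℕ) (hi : i < ℓ) :
    Matrix (Fin (n i)) (Fin (n (i + 1))) ℝ :=
  Matrix.of fun a k => W ⟨⟨i, hi⟩, (a, k)⟩

/-- `tailProd W k` is the product `W_2 W_3 ⋯ W_{k+1}` of the layers after the first one
(the identity for `k = 0`). -/
def tailProd {ℓ : ℕ} {n : ℕ → ℕ} (W : Params ℓ n) :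
    (k : ℕ) → k < ℓ → Matrix (Fin (n 1)) (Fin (n (k + 1))) ℝ
  | 0, _ => (1 : Matrix (Fin (n 1)) (Fin (n 1)) ℝ)
  | k + 1, hk => tailProd W k (Nat.lt_of_succ_lt hk) * layer W (k + 1) hk

/-- The pre-activation `W_2 W_3 ⋯ W_ℓ X` of the hidden non-linearity, with `ℓ = L + 2`. -/
def preActivation {L m : ℕ} {n : ℕ → ℕ} (X : Matrix (Fin (n (L + 2))) (Fin m) ℝ)
    (W : Params (L + 2) n) : Matrix (Fin (n 1)) (Fin m) ℝ :=
  tailProd W (L + 1) (Nat.lt_succ_self _) * X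

/-- The output `W_1 φ(W_2 W_3 ⋯ W_ℓ X)` of the network, with `φ` the leaky ReLU applied
entrywise and `ℓ = L + 2`. -/
def output {L m : ℕ} {n : ℕ → ℕ} (b : ℝ) (X : Matrix (Fin (n (L + 2))) (Fin m) ℝ)
    (W : Params (L + 2) n) : Matrix (Fin (n 0)) (Fin m) ℝ :=
  layer W 0 (Nat.succ_pos _) * (preActivation X W).map (leakyReLU b)

/-- The loss `f(W) = ‖Y - W_1 φ(W_2 W_3 ⋯ W_ℓ X)‖_F ^ 2`. -/
def loss {L m : ℕ} {n : ℕ → ℕ} (b : ℝ) (X : Matrix (Fin (n (L + 2))) (Fin m) ℝ)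
    (Y : Matrix (Fin (n 0)) (Fin m) ℝ) (W : Params (L + 2) n) : ℝ :=
  frobNorm (Y - output b X W) ^ 2

/-- `f` is twice differentiable at `x`: it is differentiable near `x` and its gradient is
differentiable at `x`. -/
def TwiceDifferentiableAt {E : Type*} [NormedAddCommGroup E] [InnerProductSpace ℝ E]
    [CompleteSpace E] (f : E → ℝ) (x : E) : Prop :=
  (∀ᶠ y in 𝓝 x, DifferentiableAt ℝ f y) ∧ DifferentiableAt ℝ (gradient f) x

/-- The Hessian of `f` at `x`: the derivative of the gradient, as a linear operator. Its
operator norm is the spectral norm of the Hessian matrix. -/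
def hessian {E : Type*} [NormedAddCommGroup E] [InnerProductSpace ℝ E]
    [CompleteSpace E] (f : E → ℝ) (x : E) : E →L[ℝ] E :=
  fderiv ℝ (gradient f) x

/-- The constant `H₀`, where `d` is the number of rows of `X`. -/
def constH0 {c d m : ℕ} (ℓ : ℕ) (b h : ℝ) (X : Matrix (Fin d) (Fin m) ℝ)
    (Y : Matrix (Fin c) (Fin m) ℝ) : ℝ :=
  (ℓ : ℝ) ^ 2 *
    (16 * (d : ℝ) ^ (ℓ - 2) * frobNorm Y ^ 2 / (h * b ^ 2 * lambdaMin (X * Xᵀ))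
        * specNorm X ^ 2
      + 2 * (4 * (d : ℝ) ^ (ℓ - 2) * frobNorm Y ^ 2 / (h * b ^ 2 * lambdaMin (X * Xᵀ)))
          ^ (((ℓ : ℝ) - 2) / (2 * (ℓ : ℝ) - 2)) * specNorm X
      + 2 * (4 / (h * b ^ 2 * lambdaMin (X * Xᵀ)) * (d : ℝ) ^ (ℓ - 2))
          ^ (((ℓ : ℝ) - 2) / (2 * (ℓ : ℝ) - 2)) * specNorm X)

/-- The constant `H₁`, where `d` is the number of rows of `X`. -/
def constH1 {c d m : ℕ} (ℓ : ℕ) (b h : ℝ) (X : Matrix (Fin d) (Fin m) ℝ)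
    (Y : Matrix (Fin c) (Fin m) ℝ) : ℝ :=
  (ℓ : ℝ) ^ 2 *
    (16 * (d : ℝ) ^ (ℓ - 2) / (h * b ^ 2 * lambdaMin (X * Xᵀ)) * specNorm X ^ 2
      + 2 * (4 * (d : ℝ) ^ (ℓ - 2) * frobNorm Y ^ 2 / (h * b ^ 2 * lambdaMin (X * Xᵀ)))
          ^ (((ℓ : ℝ) - 2) / (2 * (ℓ : ℝ) - 2)) * specNorm X
      + 2 * (4 / (h * b ^ 2 * lambdaMin (X * Xᵀ)) * (d : ℝ) ^ (ℓ - 2))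
          ^ (((ℓ : ℝ) - 2) / (2 * (ℓ : ℝ) - 2)) * specNorm X)

end DeepNet

end

open DeepNet

/-! The Hessian is symmetric, so its norm is controlled by its quadratic form. On a ray `W + t • V`,
`t ≥ 0`, every pre-activation is a polynomial in `t`, hence of constant sign for small `t`. There
the leaky ReLU is multiplication by a constant slope matrix `D`, the loss is a polynomial, and the
quadratic form is twice its `t²` coefficient (`inner_hessian_eq`, `exists_slopes`). No
pre-activation need be non-zero for this.

With all layers of Frobenius norm `s`, the output is majorised up to order two by `s ^ ℓ * ‖X‖ * exp
(ℓ * ‖V‖ / s * t)`. This gives a bound in `s` and the residual `r` (`abs_inner_hessian_loss_le`).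

Strong balance turns the Gram matrix of `W_2 ⋯ W_ℓ` into a power of that of `W_ℓ`, and the power
mean inequality bounds `s ^ (2ℓ - 2)` by the squared norm of the output (`frobNorm_layer_pow_le`),
thus by `‖Y‖² + r²`. A scalar estimate, `quadratic_bound_le`, then eliminates `s`. -/

namespace DeepNet

/-! ### Frobenius and spectral norms -/

section Norms

variable {p q r : ℕ}

theorem frobNorm_nonneg (A : Matrix (Fin p) (Fin q) ℝ) : 0 ≤ frobNorm A := by
  let _ := Matrix.frobeniusNormedAddCommGroup (m := Fin p) (n := Fin q) (α := ℝ)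
  exact norm_nonneg A

theorem frobNorm_sq (A : Matrix (Fin p) (Fin q) ℝ) :
    frobNorm A ^ 2 = ∑ i, ∑ j, A i j ^ 2 := by
  let _ := Matrix.frobeniusNormedAddCommGroup (m := Fin p) (n := Fin q) (α := ℝ)
  have h := Matrix.frobenius_norm_def A
  have h0 : 0 ≤ ∑ i, ∑ j, ‖A i j‖ ^ (2 : ℝ) := by positivity
  rw [frobNorm, h, ← Real.sqrt_eq_rpow, Real.sq_sqrt h0]
  simp

theorem frobNorm_le_of_sq_le {A : Matrix (Fin p) (Fin q) ℝ} {c : ℝ} (hc : 0 ≤ c)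
    (h : ∑ i, ∑ j, A i j ^ 2 ≤ c ^ 2) : frobNorm A ≤ c :=
  le_of_sq_le_sq (by rwa [frobNorm_sq]) hc

theorem frobNorm_zero : frobNorm (0 : Matrix (Fin p) (Fin q) ℝ) = 0 := by
  let _ := Matrix.frobeniusNormedAddCommGroup (m := Fin p) (n := Fin q) (α := ℝ)
  exact norm_zero

theorem frobNorm_add_le (A B : Matrix (Fin p) (Fin q) ℝ) :
    frobNorm (A + B) ≤ frobNorm A + frobNorm B := by
  let _ := Matrix.frobeniusNormedAddCommGroup (m := Fin p) (n := Fin q) (α := ℝ)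
  exact norm_add_le A B

theorem frobNorm_mul_le (A : Matrix (Fin p) (Fin q) ℝ) (B : Matrix (Fin q) (Fin r) ℝ) :
    frobNorm (A * B) ≤ frobNorm A * frobNorm B :=
  Matrix.frobenius_norm_mul A B

theorem frobNorm_transpose (A : Matrix (Fin p) (Fin q) ℝ) : frobNorm Aᵀ = frobNorm A := by
  rw [← sq_eq_sq₀ (frobNorm_nonneg _) (frobNorm_nonneg _), frobNorm_sq, frobNorm_sq,
    Finset.sum_comm]
  rfl

theorem specNorm_nonneg (A : Matrix (Fin p) (Fin q) ℝ) : 0 ≤ specNorm A := by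
  let _ := Matrix.instL2OpNormedAddCommGroup (m := Fin p) (n := Fin q) (𝕜 := ℝ)
  exact norm_nonneg A

theorem specNorm_transpose (A : Matrix (Fin p) (Fin q) ℝ) : specNorm Aᵀ = specNorm A := by
  have h := Matrix.l2_opNorm_conjTranspose A
  rwa [Matrix.conjTranspose_eq_transpose_of_trivial] at h

theorem sum_mulVec_sq_le (A : Matrix (Fin p) (Fin q) ℝ) (v : Fin q → ℝ) :
    ∑ i, (A *ᵥ v) i ^ 2 ≤ specNorm A ^ 2 * ∑ j, v j ^ 2 := by
  have h := Matrix.l2_opNorm_mulVec A (WithLp.toLp 2 v)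
  have h2 := pow_le_pow_left₀ (norm_nonneg _) h 2
  rw [mul_pow, EuclideanSpace.norm_sq_eq, EuclideanSpace.norm_sq_eq] at h2
  simpa [specNorm] using h2

theorem frobNorm_mul_le_specNorm (A : Matrix (Fin p) (Fin q) ℝ) (B : Matrix (Fin q) (Fin r) ℝ) :
    frobNorm (A * B) ≤ frobNorm A * specNorm B := by
  refine frobNorm_le_of_sq_le (mul_nonneg (frobNorm_nonneg _) (specNorm_nonneg _)) ?_
  rw [mul_pow, frobNorm_sq, Finset.sum_mul]
  refine Finset.sum_le_sum fun i _ => ?_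
  have h := sum_mulVec_sq_le Bᵀ (A i)
  rw [specNorm_transpose, mul_comm] at h
  refine le_trans (le_of_eq (Finset.sum_congr rfl fun j _ => ?_)) h
  rw [Matrix.mulVec_transpose]
  rfl

/-- Cauchy-Schwarz for the Frobenius inner product. -/
theorem abs_sum_mul_le_frobNorm (A B : Matrix (Fin p) (Fin q) ℝ) :
    |∑ i, ∑ j, A i j * B i j| ≤ frobNorm A * frobNorm B := by
  refine abs_le_of_sq_le_sq ?_ (mul_nonneg (frobNorm_nonneg _) (frobNorm_nonneg _))
  rw [mul_pow, frobNorm_sq, frobNorm_sq]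
  simp only [← Finset.sum_product' Finset.univ Finset.univ]
  exact Finset.sum_mul_sq_le_sq_mul_sq _ _ _

end Norms

/-! ### Smallest eigenvalue and traces of powers -/

section Spectrum

variable {p q r : ℕ}

/-- Subtracting `lambdaMin A • 1` shifts the spectrum into the non-negative reals, so the difference
is positive semidefinite. -/
theorem lambdaMin_mul_le {A : Matrix (Fin p) (Fin p) ℝ} (hA : A.IsHermitian) (v : Fin p → ℝ) :
    lambdaMin A * (v ⬝ᵥ v) ≤ v ⬝ᵥ A *ᵥ v := by
  have hB : (A - lambdaMin A • (1 : Matrix (Fin p) (Fin p) ℝ)).IsHermitian := by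
    refine hA.sub ?_
    rw [Matrix.IsHermitian, Matrix.conjTranspose_smul]
    simp
  have hps : (A - lambdaMin A • (1 : Matrix (Fin p) (Fin p) ℝ)).PosSemidef := by
    rw [hB.posSemidef_iff_eigenvalues_nonneg]
    have hspec : ∀ y ∈ spectrum ℝ (A - lambdaMin A • (1 : Matrix (Fin p) (Fin p) ℝ)), 0 ≤ y := by
      intro y hy
      rw [← Algebra.algebraMap_eq_smul_one, ← spectrum.sub_singleton_eq,
        Set.sub_singleton] at hy
      obtain ⟨x, hx, rfl⟩ := hy
      have hbdd : BddBelow (spectrum ℝ A) := by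
        rw [hA.spectrum_real_eq_range_eigenvalues]
        exact (Set.finite_range _).bddBelow
      exact sub_nonneg.2 (csInf_le hbdd hx)
    intro i
    refine hspec _ ?_
    rw [hB.spectrum_real_eq_range_eigenvalues]
    exact ⟨i, rfl⟩
  have h := hps.dotProduct_mulVec_nonneg v
  rw [Matrix.sub_mulVec, Matrix.smul_mulVec, Matrix.one_mulVec, dotProduct_sub,
    dotProduct_smul] at h
  simp only [star_trivial, smul_eq_mul] at h
  linarith

theorem lambdaMin_mul_frobNorm_sq_le_mul (A : Matrix (Fin p) (Fin q) ℝ)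
    (B : Matrix (Fin q) (Fin r) ℝ) :
    lambdaMin (B * Bᵀ) * frobNorm A ^ 2 ≤ frobNorm (A * B) ^ 2 := by
  rw [frobNorm_sq, frobNorm_sq, Finset.mul_sum]
  refine Finset.sum_le_sum fun i _ => ?_
  have h := lambdaMin_mul_le (A := B * Bᵀ) (Matrix.isHermitian_mul_conjTranspose_self B) (A i)
  have e1 : A i ⬝ᵥ A i = ∑ j, A i j ^ 2 := Finset.sum_congr rfl fun j _ => (sq _).symm
  have e2 : A i ⬝ᵥ (B * Bᵀ) *ᵥ A i = ∑ j, (A * B) i j ^ 2 := by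
    rw [← Matrix.mulVec_mulVec, Matrix.dotProduct_mulVec, Matrix.mulVec_transpose]
    exact Finset.sum_congr rfl fun j _ => (sq _).symm
  rwa [e1, e2] at h

theorem lambdaMin_mul_frobNorm_sq_le_mul_left (A : Matrix (Fin p) (Fin q) ℝ)
    (B : Matrix (Fin q) (Fin r) ℝ) :
    lambdaMin (Aᵀ * A) * frobNorm B ^ 2 ≤ frobNorm (A * B) ^ 2 := by
  have h := lambdaMin_mul_frobNorm_sq_le_mul Bᵀ Aᵀ
  rwa [Matrix.transpose_transpose, ← Matrix.transpose_mul, frobNorm_transpose,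
    frobNorm_transpose] at h

theorem trace_transpose_mul_self (A : Matrix (Fin p) (Fin q) ℝ) :
    (Aᵀ * A).trace = frobNorm A ^ 2 := by
  rw [frobNorm_sq, Finset.sum_comm]
  simp [Matrix.trace, Matrix.mul_apply, sq]

theorem trace_pow_eq_sum_eigenvalues {A : Matrix (Fin p) (Fin p) ℝ} (hA : A.IsHermitian) (k : ℕ) :
    (A ^ k).trace = ∑ i, hA.eigenvalues i ^ k := by
  conv_lhs => rw [hA.spectral_theorem]
  rw [← map_pow, Unitary.conjStarAlgAut_apply, Matrix.trace_mul_comm, ← mul_assoc,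
    Unitary.coe_star_mul_self, one_mul, Matrix.diagonal_pow, Matrix.trace_diagonal]
  rfl

/-- The power mean inequality for the eigenvalues of `Aᵀ * A`. -/
theorem frobNorm_pow_le_card_pow_mul_trace_pow (A : Matrix (Fin p) (Fin q) ℝ) (hq : 0 < q)
    (k : ℕ) :
    frobNorm A ^ (2 * (k + 1)) ≤ (q : ℝ) ^ k * ((Aᵀ * A) ^ (k + 1)).trace := by
  have hps : (Aᵀ * A).PosSemidef := Matrix.posSemidef_conjTranspose_mul_self A
  have hA := hps.isHermitian
  have h := pow_sum_div_card_le_sum_pow (s := Finset.univ) (f := hA.eigenvalues)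
    (fun i _ => hps.eigenvalues_nonneg i) k
  have ht := hA.trace_eq_sum_eigenvalues
  simp only [RCLike.ofReal_real_eq_id, id] at ht
  rw [← ht, trace_transpose_mul_self, ← trace_pow_eq_sum_eigenvalues, Finset.card_univ,
    Fintype.card_fin, div_le_iff₀ (by positivity)] at h
  rw [pow_mul]
  linarith

end Spectrum

end DeepNet

/-! ### Signs of polynomials at `0⁺` and the leaky ReLU -/

namespace DeepNet

-- If the polynomial vanishes at `0`, divide by the variable and induct on the degree: on `t ≥ 0`
-- the removed factor does not affect the sign. A two-sided version fails already for `t` itself.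
open Polynomial in
theorem eval_nonneg_or_nonpos_nhdsGE (p : ℝ[X]) :
    (∀ᶠ t in 𝓝[≥] (0 : ℝ), 0 ≤ p.eval t) ∨ (∀ᶠ t in 𝓝[≥] (0 : ℝ), p.eval t ≤ 0) := by
  induction hn : p.natDegree using Nat.strong_induction_on generalizing p with
  | _ n ih =>
    have hcont : Filter.Tendsto (fun t => p.eval t) (𝓝[≥] (0 : ℝ)) (𝓝 (p.eval 0)) :=
      (p.continuous.tendsto 0).mono_left nhdsWithin_le_nhds
    rcases lt_trichotomy (p.eval 0) 0 with h | h | h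
    · exact Or.inr ((hcont.eventually_lt_const h).mono fun _ => le_of_lt)
    · rw [← coeff_zero_eq_eval_zero] at h
      by_cases hd : p.natDegree = 0
      · left
        rw [eq_C_of_natDegree_eq_zero hd, h]
        simp
      · have hp : p.divX * X = p := by
          conv_rhs => rw [← p.divX_mul_X_add, h, map_zero, add_zero]
        have hlt : p.divX.natDegree < n := by
          rw [natDegree_divX_eq_natDegree_tsub_one]
          omega
        rw [← hp]
        simp only [eval_mul, eval_X]
        refine (ih _ hlt p.divX rfl).imp (fun H => ?_) (fun H => ?_)
        · filter_upwards [H, self_mem_nhdsWithin] with t ht ht0 using mul_nonneg ht ht0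
        · filter_upwards [H, self_mem_nhdsWithin] with t ht ht0 using
            mul_nonpos_of_nonpos_of_nonneg ht ht0
    · exact Or.inl ((hcont.eventually_const_lt h).mono fun _ => le_of_lt)

theorem leakyReLU_of_nonneg {b x : ℝ} (hb : b ≤ 1) (hx : 0 ≤ x) : leakyReLU b x = x :=
  max_eq_right (by nlinarith)

theorem leakyReLU_of_nonpos {b x : ℝ} (hb : b ≤ 1) (hx : x ≤ 0) : leakyReLU b x = b * x :=
  max_eq_left (by nlinarith)

theorem mul_sq_le_leakyReLU_sq {b x : ℝ} (hb0 : 0 < b) (hb : b ≤ 1) :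
    b ^ 2 * x ^ 2 ≤ leakyReLU b x ^ 2 := by
  rcases le_total 0 x with hx | hx
  · rw [leakyReLU_of_nonneg hb hx]
    exact mul_le_of_le_one_left (sq_nonneg x) (pow_le_one₀ hb0.le hb)
  · rw [leakyReLU_of_nonpos hb hx, mul_pow]

/-! ### Hessians through quadratic forms and rays -/

section Hessian

variable {E : Type*} [NormedAddCommGroup E] [InnerProductSpace ℝ E] [CompleteSpace E]

theorem TwiceDifferentiableAt.of_eventuallyEq {f g : E → ℝ} {x : E} (h : f =ᶠ[𝓝 x] g)
    (hg : ContDiff ℝ 2 g) : TwiceDifferentiableAt f x := by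
  constructor
  · filter_upwards [h.eventuallyEq_nhds] with y hy
    exact ((hg.differentiable two_ne_zero) y).congr_of_eventuallyEq hy
  · refine DifferentiableAt.congr_of_eventuallyEq ?_ h.gradient
    have h1 : Differentiable ℝ (fderiv ℝ g) :=
      (hg.fderiv_right (m := 1) (by norm_num)).differentiable one_ne_zero
    exact ((InnerProductSpace.toDual ℝ E).symm.toContinuousLinearEquiv.differentiable.comp h1) x

theorem TwiceDifferentiableAt.inner_hessian_comm {f : E → ℝ} {x : E}
    (h : TwiceDifferentiableAt f x) (v w : E) :
    inner ℝ (hessian f x v) w = inner ℝ v (hessian f x w) := by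
  have h1 : ∀ᶠ y in 𝓝 x, HasFDerivAt f (innerSL ℝ (gradient f y)) y :=
    h.1.mono fun y hy => hy.hasGradientAt.hasFDerivAt
  have h2 : HasFDerivAt (fun y => innerSL ℝ (gradient f y)) (innerSL ℝ ∘L hessian f x) x :=
    (innerSL ℝ).hasFDerivAt.comp x h.2.hasFDerivAt
  have h3 := second_derivative_symmetric_of_eventually h1 h2 v w
  rw [real_inner_comm (hessian f x w) v]
  exact h3

/-- A bound on the quadratic form of the Hessian bounds its operator norm. -/
theorem TwiceDifferentiableAt.norm_hessian_le {f : E → ℝ} {x : E}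
    (h : TwiceDifferentiableAt f x) {C : ℝ} (hC : 0 ≤ C)
    (hq : ∀ v, |inner ℝ (hessian f x v) v| ≤ C * ‖v‖ ^ 2) : ‖hessian f x‖ ≤ C := by
  have hsymm := h.inner_hessian_comm
  set T := hessian f x
  -- Polarisation: symmetry of `T` gives the bilinear form from its values at `v + w` and `v - w`,
  -- and the parallelogram law keeps the constant `C`.
  have key : ∀ v w : E, ‖v‖ = 1 → ‖w‖ = 1 → inner ℝ (T v) w ≤ C := by
    intro v w hv hw
    have h1 := abs_le.1 (hq (v + w))
    have h2 := abs_le.1 (hq (v - w))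
    have h3 := parallelogram_law_with_norm ℝ v w
    have h4 : inner ℝ (T (v + w)) (v + w) - inner ℝ (T (v - w)) (v - w)
        = 4 * inner ℝ (T v) w := by
      have := hsymm w v
      rw [real_inner_comm (T v) w] at this
      simp only [map_add, map_sub, inner_add_left, inner_add_right, inner_sub_left,
        inner_sub_right, this]
      ring
    rw [hv, hw] at h3
    nlinarith [h1.2, h2.1]
  refine ContinuousLinearMap.opNorm_le_of_unit_norm hC fun v hv => ?_
  by_cases h0 : T v = 0
  · simpa [h0] using hC
  · have hn : ‖T v‖ ≠ 0 := norm_ne_zero_iff.2 h0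
    have := key v (‖T v‖⁻¹ • T v) hv (by rw [norm_smul, norm_inv, norm_norm, inv_mul_cancel₀ hn])
    rwa [inner_smul_right, real_inner_self_eq_norm_sq, sq, inv_mul_cancel_left₀ hn] at this

open Polynomial in
/-- If `f` agrees with a polynomial on an initial piece of a ray, the Hessian in the direction of
the ray is given by the quadratic coefficient. -/
theorem TwiceDifferentiableAt.inner_hessian_eq {f : E → ℝ} {x v : E}
    (h : TwiceDifferentiableAt f x) {p : ℝ[X]}
    (hp : ∀ᶠ t in 𝓝[≥] (0 : ℝ), f (x + t • v) = p.eval t) :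
    inner ℝ (hessian f x v) v = 2 * p.coeff 2 := by
  set γ : ℝ → E := fun t => x + t • v with hγ
  have hγd : ∀ t, HasDerivAt γ v t := fun t => by
    have := ((hasDerivAt_id t).smul_const v).const_add x
    rwa [one_smul] at this
  have hγ0 : γ 0 = x := by simp [hγ]
  have hγc : Filter.Tendsto γ (𝓝 0) (𝓝 x) := by
    have := (hγd 0).continuousAt.tendsto
    rwa [hγ0] at this
  have hF : ∀ᶠ t in 𝓝 (0 : ℝ), HasDerivAt (fun t => f (γ t)) (inner ℝ (gradient f (γ t)) v) t := by
    filter_upwards [hγc.eventually h.1] with t ht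
    have := ht.hasGradientAt.hasFDerivAt.comp_hasDerivAt t (hγd t)
    rw [InnerProductSpace.toDual_apply_apply] at this
    exact this
  have hG : HasDerivAt (fun t => (inner ℝ (gradient f (γ t)) v : ℝ))
      (inner ℝ (hessian f x v) v) 0 := by
    have h2 : HasFDerivAt (gradient f) (hessian f x) (γ 0) := by
      rw [hγ0]
      exact h.2.hasFDerivAt
    have := (h2.comp_hasDerivAt 0 (hγd 0)).inner ℝ (hasDerivAt_const (0 : ℝ) v)
    simpa using this
  have hpos : ∀ᶠ t in 𝓝[>] (0 : ℝ),
      (inner ℝ (gradient f (γ t)) v : ℝ) = p.derivative.eval t := by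
    have hp' : ∀ᶠ t in 𝓝[>] (0 : ℝ), f (γ t) = p.eval t :=
      hp.filter_mono (nhdsWithin_mono _ Set.Ioi_subset_Ici_self)
    -- At `t > 0` the one-sided neighbourhood is a full one, so the two functions have the same
    -- derivative.
    filter_upwards [eventually_eventually_nhdsWithin.2 hp',
      hF.filter_mono nhdsWithin_le_nhds, self_mem_nhdsWithin] with t h1 h2 h3
    rw [IsOpen.nhdsWithin_eq isOpen_Ioi h3] at h1
    exact h2.unique ((p.hasDerivAt t).congr_of_eventuallyEq h1)
  have hzero : (inner ℝ (gradient f (γ 0)) v : ℝ) = p.derivative.eval 0 := by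
    have l1 := hG.continuousAt.tendsto.mono_left (nhdsWithin_le_nhds (s := Set.Ioi 0))
    have l2 := (p.derivative.continuous.tendsto 0).mono_left
      (nhdsWithin_le_nhds (s := Set.Ioi 0))
    exact tendsto_nhds_unique_of_eventuallyEq l1 l2 hpos
  -- The derivative of the gradient at `0` is two-sided, so it is determined by the right
  -- derivative, the only one that `p` gives.
  have hder : HasDerivWithinAt (fun t => (inner ℝ (gradient f (γ t)) v : ℝ))
      (p.derivative.derivative.eval 0) (Set.Ioi 0) 0 :=
    (p.derivative.hasDerivAt 0).hasDerivWithinAt.congr_of_eventuallyEq hpos hzero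
  rw [(uniqueDiffWithinAt_Ioi (0 : ℝ)).eq_deriv _ hG.hasDerivWithinAt hder,
    ← coeff_zero_eq_eval_zero, coeff_derivative, coeff_derivative]
  norm_num
  ring

end Hessian

end DeepNet

namespace DeepNet

/-! ### Exponential majorants of polynomial matrices -/

section CoeffBound

open Polynomial

variable {p q r : ℕ}

/-- The matrix of the coefficients of degree `j` of a polynomial matrix. -/
def coeffMatrix (j : ℕ) (M : Matrix (Fin p) (Fin q) ℝ[X]) : Matrix (Fin p) (Fin q) ℝ :=
  M.map fun f => f.coeff j

/-- The coefficients of degree at most two of `M` are bounded in Frobenius norm by those of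
`a * exp (τ * t)`. -/
structure CoeffBound (M : Matrix (Fin p) (Fin q) ℝ[X]) (a τ : ℝ) : Prop where
  zero : frobNorm (coeffMatrix 0 M) ≤ a
  one : frobNorm (coeffMatrix 1 M) ≤ τ * a
  two : frobNorm (coeffMatrix 2 M) ≤ τ ^ 2 / 2 * a

theorem coeffMatrix_zero_mul (M : Matrix (Fin p) (Fin q) ℝ[X]) (N : Matrix (Fin q) (Fin r) ℝ[X]) :
    coeffMatrix 0 (M * N) = coeffMatrix 0 M * coeffMatrix 0 N := by
  ext i j
  simp [coeffMatrix, Matrix.mul_apply, mul_coeff_zero]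

theorem coeffMatrix_one_mul (M : Matrix (Fin p) (Fin q) ℝ[X]) (N : Matrix (Fin q) (Fin r) ℝ[X]) :
    coeffMatrix 1 (M * N)
      = coeffMatrix 0 M * coeffMatrix 1 N + coeffMatrix 1 M * coeffMatrix 0 N := by
  ext i j
  simp [coeffMatrix, Matrix.mul_apply, mul_coeff_one, Finset.sum_add_distrib]

theorem coeff_two_mul (f g : ℝ[X]) :
    (f * g).coeff 2 = f.coeff 0 * g.coeff 2 + f.coeff 1 * g.coeff 1 + f.coeff 2 * g.coeff 0 := by
  rw [coeff_mul, Finset.Nat.sum_antidiagonal_eq_sum_range_succ_mk]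
  simp [Finset.sum_range_succ]

theorem coeffMatrix_two_mul (M : Matrix (Fin p) (Fin q) ℝ[X]) (N : Matrix (Fin q) (Fin r) ℝ[X]) :
    coeffMatrix 2 (M * N)
      = coeffMatrix 0 M * coeffMatrix 2 N + coeffMatrix 1 M * coeffMatrix 1 N
        + coeffMatrix 2 M * coeffMatrix 0 N := by
  ext i j
  simp [coeffMatrix, Matrix.mul_apply, coeff_two_mul, Finset.sum_add_distrib]

theorem coeffMatrix_mul_map_C (j : ℕ) (M : Matrix (Fin p) (Fin q) ℝ[X])
    (N : Matrix (Fin q) (Fin r) ℝ) :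
    coeffMatrix j (M * N.map C) = coeffMatrix j M * N := by
  ext i k
  simp [coeffMatrix, Matrix.mul_apply]

/-- Majorants multiply like exponentials: the cross term supplies the `τ * σ` in `(τ + σ) ^ 2 / 2`.
-/
theorem CoeffBound.mul {M : Matrix (Fin p) (Fin q) ℝ[X]} {N : Matrix (Fin q) (Fin r) ℝ[X]}
    {a τ b σ : ℝ} (hM : CoeffBound M a τ) (hN : CoeffBound N b σ) :
    CoeffBound (M * N) (a * b) (τ + σ) := by
  have key : ∀ i j (c e : ℝ), frobNorm (coeffMatrix i M) ≤ c → frobNorm (coeffMatrix j N) ≤ e →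
      frobNorm (coeffMatrix i M * coeffMatrix j N) ≤ c * e := fun i j c e h1 h2 =>
    (frobNorm_mul_le _ _).trans
      (mul_le_mul h1 h2 (frobNorm_nonneg _) ((frobNorm_nonneg _).trans h1))
  refine ⟨?_, ?_, ?_⟩
  · rw [coeffMatrix_zero_mul]
    exact key _ _ _ _ hM.zero hN.zero
  · rw [coeffMatrix_one_mul]
    refine (frobNorm_add_le _ _).trans ?_
    linarith [key _ _ _ _ hM.zero hN.one, key _ _ _ _ hM.one hN.zero]
  · rw [coeffMatrix_two_mul]
    refine (frobNorm_add_le _ _).trans ?_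
    linarith [key _ _ _ _ hM.zero hN.two, key _ _ _ _ hM.two hN.zero,
      key _ _ _ _ hM.one hN.one,
      frobNorm_add_le (coeffMatrix 0 M * coeffMatrix 2 N) (coeffMatrix 1 M * coeffMatrix 1 N)]

/-- A constant factor leaves the rate unchanged and costs only its spectral norm; this is how
`specNorm X` enters. -/
theorem CoeffBound.mul_map_C {M : Matrix (Fin p) (Fin q) ℝ[X]} {a τ : ℝ} (hM : CoeffBound M a τ)
    (N : Matrix (Fin q) (Fin r) ℝ) : CoeffBound (M * N.map C) (a * specNorm N) τ := by
  have key : ∀ j (c : ℝ), frobNorm (coeffMatrix j M) ≤ c →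
      frobNorm (coeffMatrix j (M * N.map C)) ≤ c * specNorm N := fun j c h => by
    rw [coeffMatrix_mul_map_C]
    exact (frobNorm_mul_le_specNorm _ _).trans
      (mul_le_mul_of_nonneg_right h (specNorm_nonneg _))
  refine ⟨key _ _ hM.zero, ?_, ?_⟩
  · rw [← mul_assoc]
    exact key _ _ hM.one
  · rw [← mul_assoc]
    exact key _ _ hM.two

theorem CoeffBound.hadamard {M : Matrix (Fin p) (Fin q) ℝ[X]} {a τ : ℝ} (hM : CoeffBound M a τ)
    {D : Matrix (Fin p) (Fin q) ℝ} (hD : ∀ i j, |D i j| ≤ 1) :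
    CoeffBound (D.map C ⊙ M) a τ := by
  have key : ∀ j, frobNorm (coeffMatrix j (D.map C ⊙ M)) ≤ frobNorm (coeffMatrix j M) := fun j => by
    refine frobNorm_le_of_sq_le (frobNorm_nonneg _) ?_
    rw [frobNorm_sq]
    refine Finset.sum_le_sum fun i _ => Finset.sum_le_sum fun k _ => ?_
    simp only [coeffMatrix, Matrix.map_apply, Matrix.hadamard_apply, coeff_C_mul, mul_pow]
    exact mul_le_of_le_one_left (sq_nonneg _) ((sq_le_one_iff_abs_le_one _).2 (hD i k))
  exact ⟨(key 0).trans hM.zero, (key 1).trans hM.one, (key 2).trans hM.two⟩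

/-- The quadratic coefficient of the squared Frobenius norm of `Y - M`. -/
theorem CoeffBound.abs_coeff_two_sum_sq_le {M : Matrix (Fin p) (Fin q) ℝ[X]} {a τ : ℝ}
    (hM : CoeffBound M a τ) (Y : Matrix (Fin p) (Fin q) ℝ) :
    |2 * (∑ i, ∑ j, (C (Y i j) - M i j) ^ 2).coeff 2|
      ≤ τ ^ 2 * (2 * a ^ 2 + 2 * frobNorm (Y - coeffMatrix 0 M) * a) := by
  -- Expand the square of `(Y - M₀) - t M₁ - t² M₂ - ⋯`, with `Mⱼ` the coefficient matrices.
  have h1 : (∑ i, ∑ j, (C (Y i j) - M i j) ^ 2).coeff 2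
      = -2 * (∑ i, ∑ j, (Y - coeffMatrix 0 M) i j * coeffMatrix 2 M i j)
        + frobNorm (coeffMatrix 1 M) ^ 2 := by
    rw [frobNorm_sq, finsetSum_coeff, Finset.mul_sum, ← Finset.sum_add_distrib]
    refine Finset.sum_congr rfl fun i _ => ?_
    rw [finsetSum_coeff, Finset.mul_sum, ← Finset.sum_add_distrib]
    refine Finset.sum_congr rfl fun j _ => ?_
    rw [sq, coeff_two_mul]
    simp [coeffMatrix, coeff_C]
    ring
  have h2 := abs_sum_mul_le_frobNorm (Y - coeffMatrix 0 M) (coeffMatrix 2 M)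
  have h3 := mul_le_mul_of_nonneg_left hM.two (frobNorm_nonneg (Y - coeffMatrix 0 M))
  have h4 := pow_le_pow_left₀ (frobNorm_nonneg _) hM.one 2
  have h5 := sq_nonneg (frobNorm (coeffMatrix 1 M))
  have h6 := abs_le.1 h2
  rw [h1, abs_le]
  constructor <;> nlinarith [h6.1, h6.2]

end CoeffBound

/-! ### Layers and their products along a ray -/

section Ray

open Polynomial

variable {ℓ : ℕ} {n : ℕ → ℕ}

/-- The layer of index `i` along the ray `W + t • V`, as a matrix of polynomials in `t`. -/
noncomputable def polyLayer (W V : Params ℓ n) (i : ℕ) (hi : i < ℓ) :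
    Matrix (Fin (n i)) (Fin (n (i + 1))) ℝ[X] :=
  Matrix.of fun a k => C (layer W i hi a k) + X * C (layer V i hi a k)

/-- The product of the layers after the first one along the ray `W + t • V`. -/
noncomputable def polyTail (W V : Params ℓ n) : (k : ℕ) → k < ℓ → Matrix (Fin (n 1)) (Fin (n (k + 1))) ℝ[X]
  | 0, _ => (1 : Matrix (Fin (n 1)) (Fin (n 1)) ℝ[X])
  | k + 1, hk => polyTail W V k (Nat.lt_of_succ_lt hk) * polyLayer W V (k + 1) hk

theorem polyLayer_map_eval (W V : Params ℓ n) (i : ℕ) (hi : i < ℓ) (t : ℝ) :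
    (polyLayer W V i hi).map (evalRingHom t) = layer (W + t • V) i hi := by
  ext a k
  simp [polyLayer, layer]
  ring

theorem polyTail_map_eval (W V : Params ℓ n) (t : ℝ) (k : ℕ) (hk : k < ℓ) :
    (polyTail W V k hk).map (evalRingHom t) = tailProd (W + t • V) k hk := by
  induction k with
  | zero => exact Matrix.map_one _ (map_zero _) (map_one _)
  | succ k ih => rw [polyTail, tailProd, Matrix.map_mul, ih, polyLayer_map_eval]

theorem frobNorm_layer_le_norm (V : Params ℓ n) (i : ℕ) (hi : i < ℓ) :
    frobNorm (layer V i hi) ≤ ‖V‖ := by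
  refine frobNorm_le_of_sq_le (norm_nonneg _) ?_
  rw [EuclideanSpace.norm_sq_eq, Fintype.sum_sigma]
  refine le_trans (le_of_eq ?_) (Finset.single_le_sum (f := fun i : Fin ℓ =>
    ∑ y : Fin (n i) × Fin (n (i + 1)), ‖V ⟨i, y⟩‖ ^ 2)
    (fun _ _ => Finset.sum_nonneg fun _ _ => sq_nonneg _) (Finset.mem_univ ⟨i, hi⟩))
  rw [Fintype.sum_prod_type]
  simp [layer]

/-- The layer is affine in `t`, and the rate is chosen so that rate times `s` is `‖V‖`. -/
theorem coeffBound_polyLayer (W V : Params ℓ n) (i : ℕ) (hi : i < ℓ) {s : ℝ} (hs : 0 < s)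
    (hW : frobNorm (layer W i hi) = s) : CoeffBound (polyLayer W V i hi) s (‖V‖ / s) := by
  have h0 : coeffMatrix 0 (polyLayer W V i hi) = layer W i hi := by
    ext a k
    simp [coeffMatrix, polyLayer]
  have h1 : coeffMatrix 1 (polyLayer W V i hi) = layer V i hi := by
    ext a k
    simp [coeffMatrix, polyLayer, coeff_C]
  have h2 : coeffMatrix 2 (polyLayer W V i hi) = 0 := by
    ext a k
    simp [coeffMatrix, polyLayer]
  refine ⟨by rw [h0, hW], ?_, ?_⟩
  · rw [h1, div_mul_cancel₀ _ hs.ne']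
    exact frobNorm_layer_le_norm V i hi
  · rw [h2, frobNorm_zero]
    positivity

/-- Rates add over the factors. The induction starts at one layer since the empty product is an
identity matrix, whose Frobenius norm can exceed `s ^ 0`. -/
theorem coeffBound_polyTail (W V : Params ℓ n) {s : ℝ} (hs : 0 < s)
    (hW : ∀ i hi, frobNorm (layer W i hi) = s) (k : ℕ) (hk : k + 1 < ℓ) :
    CoeffBound (polyTail W V (k + 1) hk) (s ^ (k + 1)) ((k + 1) * (‖V‖ / s)) := by
  induction k with
  | zero =>
    have := coeffBound_polyLayer W V 1 hk hs (hW _ _)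
    simpa [polyTail] using this
  | succ k ih =>
    have := (ih (by omega)).mul (coeffBound_polyLayer W V (k + 1 + 1) hk hs (hW _ _))
    rw [polyTail, pow_succ]
    convert this using 1
    push_cast
    ring

end Ray

/-! ### The loss along a ray -/

section Loss

variable {L m : ℕ} {n : ℕ → ℕ}

theorem polyTail_mul_map_eval (X : Matrix (Fin (n (L + 2))) (Fin m) ℝ) (W V : Params (L + 2) n)
    (t : ℝ) :
    (polyTail W V (L + 1) (Nat.lt_succ_self _) * X.map Polynomial.C).map (Polynomial.evalRingHom t)
      = preActivation X (W + t • V) := by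
  rw [Matrix.map_mul, polyTail_map_eval, preActivation]
  congr 1
  ext a k
  simp

/-- Along any ray, each unit of the hidden layer has a constant slope for small times. -/
theorem exists_slopes {b : ℝ} (hb0 : 0 < b) (hb1 : b ≤ 1)
    (X : Matrix (Fin (n (L + 2))) (Fin m) ℝ) (W V : Params (L + 2) n) :
    ∃ D : Matrix (Fin (n 1)) (Fin m) ℝ, (∀ i j, |D i j| ≤ 1) ∧
      ∀ᶠ t in 𝓝[≥] (0 : ℝ), (preActivation X (W + t • V)).map (leakyReLU b)
        = D ⊙ preActivation X (W + t • V) := by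
  have hpoly : ∀ t i j, preActivation X (W + t • V) i j
      = ((polyTail W V (L + 1) (Nat.lt_succ_self _) * X.map Polynomial.C) i j).eval t := by
    intro t i j
    rw [← polyTail_mul_map_eval]
    rfl
  have key : ∀ i j, ∃ δ : ℝ, |δ| ≤ 1 ∧ ∀ᶠ t in 𝓝[≥] (0 : ℝ),
      leakyReLU b (preActivation X (W + t • V) i j) = δ * preActivation X (W + t • V) i j := by
    intro i j
    simp only [hpoly]
    rcases eval_nonneg_or_nonpos_nhdsGE
      ((polyTail W V (L + 1) (Nat.lt_succ_self _) * X.map Polynomial.C) i j) with h | h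
    · exact ⟨1, by simp, h.mono fun t ht => by rw [leakyReLU_of_nonneg hb1 ht, one_mul]⟩
    · exact ⟨b, by rwa [abs_of_pos hb0], h.mono fun t ht => leakyReLU_of_nonpos hb1 ht⟩
  choose D hD1 hD2 using key
  refine ⟨Matrix.of D, hD1, ?_⟩
  filter_upwards [Filter.eventually_all.2 fun i => Filter.eventually_all.2 fun j => hD2 i j]
    with t ht
  ext i j
  exact ht i j

/-- The output has majorant size `s ^ (L + 2) * specNorm X` and rate `(L + 2) * ‖V‖ / s`; the
squared rate cancels two powers of `s`. -/
theorem abs_inner_hessian_loss_le {b : ℝ} (hb0 : 0 < b) (hb1 : b ≤ 1)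
    (X : Matrix (Fin (n (L + 2))) (Fin m) ℝ) (Y : Matrix (Fin (n 0)) (Fin m) ℝ)
    (W : Params (L + 2) n) {s : ℝ} (hs : 0 < s) (hW : ∀ i hi, frobNorm (layer W i hi) = s)
    (h : TwiceDifferentiableAt (loss b X Y) W) (V : Params (L + 2) n) :
    |inner ℝ (hessian (loss b X Y) W V) V|
      ≤ ((L + 2 : ℕ) : ℝ) ^ 2 * (2 * s ^ (2 * L + 2) * specNorm X ^ 2
        + 2 * frobNorm (Y - output b X W) * s ^ L * specNorm X) * ‖V‖ ^ 2 := by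
  obtain ⟨D, hD1, hD2⟩ := exists_slopes hb0 hb1 X W V
  set M := polyLayer W V 0 (Nat.succ_pos _) *
    (D.map Polynomial.C ⊙ (polyTail W V (L + 1) (Nat.lt_succ_self _) * X.map Polynomial.C))
    with hMdef
  have hM : CoeffBound M (s * (s ^ (L + 1) * specNorm X))
      (‖V‖ / s + ((L + 1 : ℕ) : ℝ) * (‖V‖ / s)) := by
    have h1 := ((coeffBound_polyTail W V hs hW L (Nat.lt_succ_self _)).mul_map_C X).hadamard hD1
    have h2 := (coeffBound_polyLayer W V 0 (Nat.succ_pos _) hs (hW _ _)).mul h1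
    exact_mod_cast h2
  have hMt : ∀ᶠ t in 𝓝[≥] (0 : ℝ), M.map (Polynomial.evalRingHom t) = output b X (W + t • V) := by
    filter_upwards [hD2] with t ht
    rw [output, ht, hMdef, Matrix.map_mul, polyLayer_map_eval]
    congr 1
    rw [← polyTail_mul_map_eval]
    ext i j
    simp
  have hp : ∀ᶠ t in 𝓝[≥] (0 : ℝ), loss b X Y (W + t • V)
      = (∑ i, ∑ j, (Polynomial.C (Y i j) - M i j) ^ 2).eval t := by
    filter_upwards [hMt] with t ht
    rw [loss, frobNorm_sq, ← ht]
    simp [Polynomial.eval_finsetSum]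
  have h0 : coeffMatrix 0 M = output b X W := by
    -- The filter `𝓝[≥] 0` contains the point `0` itself, so the identity holds at `t = 0`.
    have := hMt.self_of_nhdsWithin (Set.mem_Ici.2 le_rfl)
    rw [zero_smul, add_zero] at this
    rw [← this]
    ext i j
    simp [coeffMatrix, Polynomial.coeff_zero_eq_eval_zero]
  rw [h.inner_hessian_eq hp]
  refine (hM.abs_coeff_two_sum_sq_le Y).trans (le_of_eq ?_)
  rw [h0]
  push_cast
  field_simp
  ring

end Loss

end DeepNet

/-! ### Positivity and the scalar estimate -/

namespace DeepNet

/-- An empty matrix has empty spectrum, and `sInf ∅ = 0`. -/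
theorem pos_of_lambdaMin_pos {p : ℕ} {A : Matrix (Fin p) (Fin p) ℝ} (h : 0 < lambdaMin A) :
    0 < p := by
  rcases Nat.eq_zero_or_pos p with rfl | hp
  · rw [lambdaMin, spectrum.of_subsingleton, Real.sInf_empty] at h
    exact absurd h (lt_irrefl _)
  · exact hp

theorem frobNorm_pos_of_lambdaMin_pos {p q : ℕ} {A : Matrix (Fin p) (Fin q) ℝ}
    (h : 0 < lambdaMin (Aᵀ * A)) : 0 < frobNorm A := by
  have hq := pos_of_lambdaMin_pos h
  have h1 := lambdaMin_mul_frobNorm_sq_le_mul_left A (1 : Matrix (Fin q) (Fin q) ℝ)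
  have h2 : frobNorm (1 : Matrix (Fin q) (Fin q) ℝ) ^ 2 = q := by
    rw [frobNorm_sq]
    simp [Matrix.one_apply]
  rw [h2, Matrix.mul_one] at h1
  refine (frobNorm_nonneg A).lt_of_ne fun h0 => ?_
  rw [← h0] at h1
  have : 0 < lambdaMin (Aᵀ * A) * q := by positivity
  linarith

/-- The scalar estimate which turns the bound on the Hessian into one by the loss. -/
theorem quadratic_bound_le {L : ℕ} {s K y r x : ℝ} (hs : 0 < s) (hK : 0 ≤ K) (hy : 0 ≤ y)
    (hr : 0 ≤ r) (hx : 0 ≤ x) (h : s ^ (2 * L + 2) ≤ 2 * K * (y + r ^ 2)) :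
    2 * s ^ (2 * L + 2) * x ^ 2 + 2 * r * s ^ L * x
      ≤ (16 * K * y * x ^ 2 + 2 * (4 * K * y) ^ ((L : ℝ) / (2 * L + 2)) * x
          + 2 * (4 * K) ^ ((L : ℝ) / (2 * L + 2)) * x)
        + (16 * K * x ^ 2 + 2 * (4 * K * y) ^ ((L : ℝ) / (2 * L + 2)) * x
          + 2 * (4 * K) ^ ((L : ℝ) / (2 * L + 2)) * x) * r ^ 2 := by
  set θ : ℝ := (L : ℝ) / (2 * L + 2) with hθ
  have hL : (0 : ℝ) ≤ L := Nat.cast_nonneg L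
  have hθ0 : 0 ≤ θ := by positivity
  have hθ1 : θ ≤ 1 / 2 := by
    rw [hθ, div_le_div_iff₀ (by positivity) two_pos]
    linarith
  have hsL : s ^ L = (s ^ (2 * L + 2)) ^ θ := by
    rw [← Real.rpow_natCast s (2 * L + 2), ← Real.rpow_mul hs.le, ← Real.rpow_natCast]
    congr 1
    rw [hθ]
    push_cast
    field_simp
  have hP : 0 ≤ (4 * K * y) ^ θ := by positivity
  have hQ : 0 ≤ (4 * K) ^ θ := by positivity
  have hR : 0 ≤ (r ^ 2) ^ θ := by positivity
  -- Bounding `y + r ^ 2` by twice the larger term, `2 * K` becomes `4 * K` and one of the two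
  -- summands suffices. For `L = 0` the exponent `θ` is `0` and all these powers are `1`, even at
  -- base `0`.
  have hsum : s ^ L ≤ (4 * K * y) ^ θ + (4 * K) ^ θ * (r ^ 2) ^ θ := by
    rw [hsL, ← Real.mul_rpow (by positivity) (by positivity)]
    rcases le_total y (r ^ 2) with hyr | hyr
    · refine le_add_of_nonneg_of_le hP (Real.rpow_le_rpow (by positivity) ?_ hθ0)
      nlinarith
    · refine le_add_of_le_of_nonneg (Real.rpow_le_rpow (by positivity) ?_ hθ0) (by positivity)
      nlinarith
  have hr1 : r ≤ 1 + r ^ 2 := by nlinarith [sq_nonneg (r - 1)]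
  -- Since `0 ≤ θ ≤ 1 / 2`, the left side is at most `r` when `r ≤ 1` and at most `r ^ 2` otherwise.
  have hr2 : r * (r ^ 2) ^ θ ≤ 1 + r ^ 2 := by
    rcases le_total r 1 with h1 | h1
    · have : (r ^ 2) ^ θ ≤ 1 := Real.rpow_le_one (sq_nonneg r) (pow_le_one₀ hr h1) hθ0
      nlinarith
    · have : (r ^ 2) ^ θ ≤ r := by
        calc (r ^ 2) ^ θ ≤ (r ^ 2) ^ (1 / 2 : ℝ) :=
              Real.rpow_le_rpow_of_exponent_le (one_le_pow₀ h1) hθ1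
          _ = r := by rw [← Real.sqrt_eq_rpow, Real.sqrt_sq hr]
      nlinarith
  have e1 : 2 * s ^ (2 * L + 2) * x ^ 2 ≤ 16 * K * y * x ^ 2 + 16 * K * x ^ 2 * r ^ 2 := by
    have h1 := mul_le_mul_of_nonneg_right h (sq_nonneg x)
    have h2 : 0 ≤ K * y * x ^ 2 := by positivity
    have h3 : 0 ≤ K * x ^ 2 * r ^ 2 := by positivity
    nlinarith
  have e2 : r * s ^ L ≤ ((4 * K * y) ^ θ + (4 * K) ^ θ) * (1 + r ^ 2) := by
    have h1 := mul_le_mul_of_nonneg_left hsum hr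
    have h2 := mul_le_mul_of_nonneg_left hr1 hP
    have h3 := mul_le_mul_of_nonneg_left hr2 hQ
    nlinarith
  have e3 := mul_le_mul_of_nonneg_right e2 hx
  nlinarith

/-! ### Consequences of balancedness -/

section Balanced

variable {L m : ℕ} {n : ℕ → ℕ}

/-- The Gram matrix telescopes: strong balance rewrites the inner power through the next layer `A`
as `(A * Aᵀ) ^ j`, and `Aᵀ * (A * Aᵀ) ^ j * A = (Aᵀ * A) ^ (j + 1)`. -/
theorem tailProd_transpose_mul_self (W : Params (L + 2) n)
    (hstrong : ∀ (i : ℕ) (hi : i + 1 < L + 2), 1 ≤ i →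
      (layer W i (Nat.lt_of_succ_lt hi))ᵀ * layer W i (Nat.lt_of_succ_lt hi)
        = layer W (i + 1) hi * (layer W (i + 1) hi)ᵀ) (k : ℕ) (hk : k + 1 < L + 2) :
    (tailProd W (k + 1) hk)ᵀ * tailProd W (k + 1) hk
      = ((layer W (k + 1) hk)ᵀ * layer W (k + 1) hk) ^ (k + 1) := by
  induction k with
  | zero => simp [tailProd]
  | succ k ih =>
    have h1 := ih (by omega)
    have hcomm : ∀ {p q : ℕ} (A : Matrix (Fin p) (Fin q) ℝ) (j : ℕ),
        Aᵀ * (A * Aᵀ) ^ j * A = (Aᵀ * A) ^ (j + 1) := by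
      intro p q A j
      induction j with
      | zero => simp
      | succ j ihj =>
        rw [pow_succ (Aᵀ * A), ← ihj, pow_succ]
        simp only [Matrix.mul_assoc]
    rw [tailProd, Matrix.transpose_mul, Matrix.mul_assoc,
      ← Matrix.mul_assoc (tailProd W (k + 1) _)ᵀ, h1, hstrong (k + 1) hk (by omega),
      ← Matrix.mul_assoc, hcomm]

/-- Balancedness bounds the size of the layers by that of the output. -/
theorem frobNorm_layer_pow_le {b h : ℝ} (hb0 : 0 < b) (hb1 : b ≤ 1) (hh : 0 < h)
    (X : Matrix (Fin (n (L + 2))) (Fin m) ℝ) (hX : 0 < lambdaMin (X * Xᵀ))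
    (W : Params (L + 2) n)
    (hW1 : h ≤ lambdaMin ((layer W 0 (Nat.succ_pos _))ᵀ * layer W 0 (Nat.succ_pos _)))
    (hstrong : ∀ (i : ℕ) (hi : i + 1 < L + 2), 1 ≤ i →
      (layer W i (Nat.lt_of_succ_lt hi))ᵀ * layer W i (Nat.lt_of_succ_lt hi)
        = layer W (i + 1) hi * (layer W (i + 1) hi)ᵀ) :
    h * b ^ 2 * lambdaMin (X * Xᵀ) * frobNorm (layer W (L + 1) (Nat.lt_succ_self _)) ^ (2 * (L + 1))
      ≤ (n (L + 2) : ℝ) ^ L * frobNorm (output b X W) ^ 2 := by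
  have h1 := frobNorm_pow_le_card_pow_mul_trace_pow (layer W (L + 1) (Nat.lt_succ_self _))
    (pos_of_lambdaMin_pos hX) L
  rw [← tailProd_transpose_mul_self W hstrong L (by omega), trace_transpose_mul_self] at h1
  have h2 := lambdaMin_mul_frobNorm_sq_le_mul (tailProd W (L + 1) (Nat.lt_succ_self _)) X
  have h3 : b ^ 2 * frobNorm (preActivation X W) ^ 2
      ≤ frobNorm ((preActivation X W).map (leakyReLU b)) ^ 2 := by
    rw [frobNorm_sq, frobNorm_sq, Finset.mul_sum]
    refine Finset.sum_le_sum fun i _ => ?_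
    rw [Finset.mul_sum]
    exact Finset.sum_le_sum fun j _ => mul_sq_le_leakyReLU_sq hb0 hb1
  have h4 := lambdaMin_mul_frobNorm_sq_le_mul_left (layer W 0 (Nat.succ_pos _))
    ((preActivation X W).map (leakyReLU b))
  -- Each factor on the left pays for one passage towards the output: `lambdaMin (X * Xᵀ)` for `X`,
  -- `b ^ 2` for the leaky ReLU, `h` for the first layer.
  calc h * b ^ 2 * lambdaMin (X * Xᵀ) * frobNorm (layer W (L + 1) (Nat.lt_succ_self _)) ^ (2 * (L + 1))
      ≤ h * b ^ 2 * lambdaMin (X * Xᵀ) *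
          ((n (L + 2) : ℝ) ^ L * frobNorm (tailProd W (L + 1) (Nat.lt_succ_self _)) ^ 2) :=
        mul_le_mul_of_nonneg_left h1 (by positivity)
    _ = (n (L + 2) : ℝ) ^ L * (h * (b ^ 2 *
          (lambdaMin (X * Xᵀ) * frobNorm (tailProd W (L + 1) (Nat.lt_succ_self _)) ^ 2))) := by ring
    _ ≤ (n (L + 2) : ℝ) ^ L * (h * (b ^ 2 * frobNorm (preActivation X W) ^ 2)) := by
        gcongr
        exact h2
    _ ≤ (n (L + 2) : ℝ) ^ L * (h * frobNorm ((preActivation X W).map (leakyReLU b)) ^ 2) := by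
        gcongr
    _ ≤ (n (L + 2) : ℝ) ^ L *
          (lambdaMin ((layer W 0 (Nat.succ_pos _))ᵀ * layer W 0 (Nat.succ_pos _)) *
            frobNorm ((preActivation X W).map (leakyReLU b)) ^ 2) := by
        gcongr
    _ ≤ (n (L + 2) : ℝ) ^ L * frobNorm (output b X W) ^ 2 :=
        mul_le_mul_of_nonneg_left h4 (by positivity)

theorem frobNorm_sq_le_two_mul {p q : ℕ} (A B : Matrix (Fin p) (Fin q) ℝ) :
    frobNorm B ^ 2 ≤ 2 * (frobNorm A ^ 2 + frobNorm (A - B) ^ 2) := by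
  simp only [frobNorm_sq, ← Finset.sum_add_distrib, Finset.mul_sum]
  refine Finset.sum_le_sum fun i _ => Finset.sum_le_sum fun j _ => ?_
  rw [Matrix.sub_apply]
  nlinarith [sq_nonneg (2 * A i j - B i j)]

theorem norm_hessian_loss_le {b h : ℝ} (hb0 : 0 < b) (hb1 : b ≤ 1) (hh : 0 < h)
    (X : Matrix (Fin (n (L + 2))) (Fin m) ℝ) (Y : Matrix (Fin (n 0)) (Fin m) ℝ)
    (hX : 0 < lambdaMin (X * Xᵀ)) (W : Params (L + 2) n)
    (hW1 : h ≤ lambdaMin ((layer W 0 (Nat.succ_pos _))ᵀ * layer W 0 (Nat.succ_pos _)))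
    (hweak : ∀ (i : ℕ) (hi : i < L + 2),
      frobNorm (layer W i hi) = frobNorm (layer W 0 (Nat.succ_pos _)))
    (hstrong : ∀ (i : ℕ) (hi : i + 1 < L + 2), 1 ≤ i →
      (layer W i (Nat.lt_of_succ_lt hi))ᵀ * layer W i (Nat.lt_of_succ_lt hi)
        = layer W (i + 1) hi * (layer W (i + 1) hi)ᵀ)
    (htd : TwiceDifferentiableAt (loss b X Y) W) :
    ‖hessian (loss b X Y) W‖
      ≤ constH0 (L + 2) b h X Y + constH1 (L + 2) b h X Y * loss b X Y W := by
  have hs := frobNorm_pos_of_lambdaMin_pos (hh.trans_le hW1)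
  have hpow := frobNorm_layer_pow_le hb0 hb1 hh X hX W hW1 hstrong
  -- Weak balance carries the bound on the last layer over to the common norm `s`.
  rw [hweak] at hpow
  set s := frobNorm (layer W 0 (Nat.succ_pos _)) with hsdef
  set K : ℝ := (n (L + 2) : ℝ) ^ L / (h * b ^ 2 * lambdaMin (X * Xᵀ)) with hK
  have hden : 0 < h * b ^ 2 * lambdaMin (X * Xᵀ) := by positivity
  have hr0 := frobNorm_nonneg (Y - output b X W)
  have hx0 := specNorm_nonneg X
  have hK0 : 0 ≤ K := by positivity
  have hsK : s ^ (2 * L + 2) ≤ 2 * K * (frobNorm Y ^ 2 + frobNorm (Y - output b X W) ^ 2) := by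
    have h1 := mul_le_mul_of_nonneg_left (frobNorm_sq_le_two_mul Y (output b X W))
      (show (0 : ℝ) ≤ (n (L + 2) : ℝ) ^ L by positivity)
    have h2 : s ^ (2 * L + 2) ≤ (n (L + 2) : ℝ) ^ L *
        (2 * (frobNorm Y ^ 2 + frobNorm (Y - output b X W) ^ 2)) /
          (h * b ^ 2 * lambdaMin (X * Xᵀ)) := by
      rw [le_div_iff₀ hden, mul_comm]
      exact hpow.trans h1
    refine h2.trans (le_of_eq ?_)
    rw [hK]
    ring
  have hq := quadratic_bound_le hs hK0 (sq_nonneg (frobNorm Y)) hr0 hx0 hsK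
  refine (htd.norm_hessian_le (by positivity)
    (abs_inner_hessian_loss_le hb0 hb1 X Y W hs hweak htd)).trans ?_
  refine (mul_le_mul_of_nonneg_left hq (sq_nonneg _)).trans (le_of_eq ?_)
  have hexp : (((L + 2 : ℕ) : ℝ) - 2) / (2 * ((L + 2 : ℕ) : ℝ) - 2) = (L : ℝ) / (2 * L + 2) := by
    push_cast
    congr 1 <;> ring
  have e1 : 4 * (n (L + 2) : ℝ) ^ L * frobNorm Y ^ 2 / (h * b ^ 2 * lambdaMin (X * Xᵀ))
      = 4 * K * frobNorm Y ^ 2 := by rw [hK]; ring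
  have e2 : 4 / (h * b ^ 2 * lambdaMin (X * Xᵀ)) * (n (L + 2) : ℝ) ^ L = 4 * K := by
    rw [hK]; ring
  rw [constH0, constH1, hexp, Nat.add_sub_cancel, e1, e2, loss, hK]
  ring

end Balanced

/-! ### Twice differentiability off the kinks -/

section Smooth

variable {L m : ℕ} {n : ℕ → ℕ}

theorem contDiff_layer {ℓ : ℕ} (i : ℕ) (hi : i < ℓ) (a : Fin (n i)) (k : Fin (n (i + 1))) :
    ContDiff ℝ 2 fun W : Params ℓ n => layer W i hi a k := by
  unfold layer
  simp only [Matrix.of_apply]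
  fun_prop

theorem contDiff_tailProd {ℓ : ℕ} (k : ℕ) (hk : k < ℓ) (i : Fin (n 1)) (j : Fin (n (k + 1))) :
    ContDiff ℝ 2 fun W : Params ℓ n => tailProd W k hk i j := by
  induction k with
  | zero => exact contDiff_const
  | succ k ih =>
    simp only [tailProd, Matrix.mul_apply]
    exact ContDiff.sum fun l _ => (ih _ _).mul (contDiff_layer _ _ _ _)

theorem contDiff_preActivation (X : Matrix (Fin (n (L + 2))) (Fin m) ℝ) (i : Fin (n 1))
    (j : Fin m) : ContDiff ℝ 2 fun W : Params (L + 2) n => preActivation X W i j := by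
  simp only [preActivation, Matrix.mul_apply]
  exact ContDiff.sum fun l _ => (contDiff_tailProd _ _ _ _).mul contDiff_const

/-- Non-zero pre-activations keep their signs in a full neighbourhood by continuity, so the slopes
are locally constant and the loss agrees there with a smooth function. -/
theorem twiceDifferentiableAt_loss {b : ℝ} (hb1 : b ≤ 1)
    (X : Matrix (Fin (n (L + 2))) (Fin m) ℝ) (Y : Matrix (Fin (n 0)) (Fin m) ℝ)
    (W : Params (L + 2) n) (hW : ∀ a k, preActivation X W a k ≠ 0) :
    TwiceDifferentiableAt (loss b X Y) W := by
  have key : ∀ i j, ∃ δ : ℝ, ∀ᶠ V in 𝓝 W,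
      leakyReLU b (preActivation X V i j) = δ * preActivation X V i j := by
    intro i j
    have hc := (contDiff_preActivation X i j).continuous.tendsto W
    rcases (hW i j).lt_or_gt with h | h
    · exact ⟨b, (hc.eventually_lt_const h).mono fun V hV => leakyReLU_of_nonpos hb1 hV.le⟩
    · exact ⟨1, (hc.eventually_const_lt h).mono fun V hV => by
        rw [leakyReLU_of_nonneg hb1 hV.le, one_mul]⟩
  choose D hD using key
  refine TwiceDifferentiableAt.of_eventuallyEq (g := fun V => ∑ i, ∑ j, (Y i j -
    ∑ k, layer V 0 (Nat.succ_pos _) i k * (D k j * preActivation X V k j)) ^ 2) ?_ ?_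
  · filter_upwards [Filter.eventually_all.2 fun i => Filter.eventually_all.2 fun j => hD i j]
      with V hV
    rw [loss, frobNorm_sq]
    simp only [output, Matrix.sub_apply, Matrix.mul_apply, Matrix.map_apply, hV]
  · exact ContDiff.sum fun i _ => ContDiff.sum fun j _ =>
      (contDiff_const.sub (ContDiff.sum fun k _ => (contDiff_layer _ _ _ _).mul
        (contDiff_const.mul (contDiff_preActivation X k j)))).pow 2

end Smooth

end DeepNet

theorem mainTheorem7 (L m : ℕ) (n : ℕ → ℕ)
    (X : Matrix (Fin (n (L + 2))) (Fin m) ℝ) (Y : Matrix (Fin (n 0)) (Fin m) ℝ)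
    (b h : ℝ) (hb0 : 0 < b) (hb1 : b ≤ 1) (hh : 0 < h)
    (hX : 0 < lambdaMin (X * Xᵀ))
    (W : Params (L + 2) n)
    (hW1 : h ≤ lambdaMin ((layer W 0 (by omega))ᵀ * layer W 0 (by omega)))
    (hweak : ∀ (i : ℕ) (hi : i < L + 2),
      frobNorm (layer W i hi) = frobNorm (layer W 0 (by omega)))
    (hstrong : ∀ (i : ℕ) (hi : i + 1 < L + 2), 1 ≤ i →
      (layer W i (by omega))ᵀ * layer W i (by omega)
        = layer W (i + 1) hi * (layer W (i + 1) hi)ᵀ) :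
    ((∀ a k, preActivation X W a k ≠ 0) → TwiceDifferentiableAt (loss b X Y) W) ∧
    (TwiceDifferentiableAt (loss b X Y) W →
      ‖hessian (loss b X Y) W‖
          ≤ constH0 (L + 2) b h X Y + constH1 (L + 2) b h X Y * loss b X Y W ∧
      ‖hessian (loss b X Y) W‖
          ≤ (constH0 (L + 2) b h X Y + constH1 (L + 2) b h X Y * ⨅ V, loss b X Y V)
            + constH1 (L + 2) b h X Y * (loss b X Y W - ⨅ V, loss b X Y V)) := by
  refine ⟨twiceDifferentiableAt_loss hb1 X Y W, fun h => ?_⟩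
  have key := norm_hessian_loss_le hb0 hb1 hh X Y hX W hW1 hweak hstrong h
  refine ⟨key, key.trans (le_of_eq ?_)⟩
  ring
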